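/- Let $n \ge 0$ and let $T \in \mathrm{GL}(n,\mathbb{Q})$. Let $\mathcal{C}_{\mathrm{GL}(n,\mathbb{R})}(T)$ be the centralizer of $T$ in $\mathrm{GL}(n,\mathbb{R})$, with its usual topology, and let $\mathcal{C}_{\mathrm{GL}(n,\mathbb{Z})}(T) = \{A \in \mathrm{GL}(n,\mathbb{Z}) : AT = TA\}$. The quotient of $\mathcal{C}_{\mathrm{GL}(n,\mathbb{R})}(T)$ by its solvable radical (its maximal normal solvable subgroup), with the quotient topology, is non-compact if and only if $\mathcal{C}_{\mathrm{GL}(n,\mathbb{Z})}(T)$ contains a non-abelian free subgroup. -/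

import Mathlib

/-- The solvable radical of a group: the subgroup generated by all normal solvable subgroups.
It is the maximal normal solvable subgroup whenever there is one
(see `eq_solvableRadical_of_isGreatest`), as is the case for every linear group. -/
def solvableRadical (G : Type*) [Group G] : Subgroup G :=
  sSup {N : Subgroup G | N.Normal ∧ Group.IsSolvable N}

theorem eq_solvableRadical_of_isGreatest {G : Type*} [Group G] {R : Subgroup G}
    (hR : IsGreatest {N : Subgroup G | N.Normal ∧ Group.IsSolvable N} R) :
    R = solvableRadical G :=
  hR.isLUB.sSup_eq.symm

/-- The centralizer in `GL(n, ℝ)` of a rational matrix `T`. -/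
abbrev realCentralizer {n : ℕ} (T : GL (Fin n) ℚ) : Subgroup (GL (Fin n) ℝ) :=
  Subgroup.centralizer {Matrix.GeneralLinearGroup.map (algebraMap ℚ ℝ) T}

/-- The centralizer in `GL(n, ℤ)` of a rational matrix `T`: the integral matrices, invertible
over the integers, that commute with `T` in `GL(n, ℚ)`. -/
abbrev integralCentralizer {n : ℕ} (T : GL (Fin n) ℚ) : Subgroup (GL (Fin n) ℤ) :=
  (Subgroup.centralizer {T}).comap (Matrix.GeneralLinearGroup.map (algebraMap ℤ ℚ))

/-- The group `G` contains a non-abelian free subgroup. -/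
def ContainsNonabelianFreeSubgroup (G : Type*) [Group G] : Prop :=
  ∃ H : Subgroup G, IsFreeGroup H ∧ ∃ a b : H, a * b ≠ b * a

/-!
Let `C` be the algebra of rational matrices commuting with `T`, and let `e`, `f` stand for a pair of
nonzero matrices that multiply like the matrix units `E₁₂` and `E₂₁`. The proof is a dichotomy.

Decompose the `ℚ[X]`-module defined by `T` into cyclic modules `ℚ[X] ⧸ (qᵢ ^ kᵢ)`. If two of the
summands are isomorphic, then `C` contains such a pair `e`, `f`. If not, then every composition
`Mᵢ → Mⱼ → Mᵢ` with `i ≠ j` is nilpotent, so the trace of a product of three elements of `C` only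
sees the diagonal blocks, which commute; hence `tr ((a * b - b * a) * c) = 0` on `C`
(`Matrix.exists_isMatrixUnitPair_or_trace_commutator_eq_zero`).

* In the second case the trace identity extends to the real centralizer, which is spanned by `C`. A
  matrix whose powers are all traceless is nilpotent, so the identity puts all commutators into the
  Jacobson radical, a nilpotent ideal, and the centralizers are solvable groups
  (`Matrix.isSolvable_centralizer_of_trace_commutator_eq_zero`). The quotient by the solvable radical
  is then trivial, and there are no non-abelian free subgroups.

* In the first case, for a suitable integer `a` the matrices `1 + a e` and `1 + a f` are integral and
  generate a free group, by ping-pong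
  (`containsNonabelianFreeSubgroup_integralCentralizer`). On the real side, every normal solvable
  subgroup of the centralizer is central modulo the radical of the trace form
  (`coe_mem_centralModTraceRadical_of_mem_solvableRadical`): by induction along the derived series it
  suffices to consider a normal subgroup `M` whose commutators are central modulo the radical, and
  differentiating commutators of `m ∈ M` with its conjugates shows that the square of the
  derivation `[m, ·]` vanishes modulo the radical, which forces the derivation to vanish. Therefore
  `g ↦ tr (g * e * g⁻¹ * e)` descends to the quotient by the solvable radical. At `g = 1 + t f` it
  takes the value `-t² * tr (f * e)`, so it is unbounded and the quotient is not compact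
  (`not_compactSpace_quotient_solvableRadical`).
-/

/-! ### Nilpotency from traces -/

open Polynomial in
/-- A square matrix over a field of characteristic zero is nilpotent as soon as all its positive
powers have trace zero. -/
theorem Matrix.isNilpotent_of_trace_pow_eq_zero {K : Type*} [Field K] [CharZero K] {n : ℕ}
    (M : Matrix (Fin n) (Fin n) K) (h : ∀ k, 1 ≤ k → (M ^ k).trace = 0) : IsNilpotent M := by
  have htr (q : K[X]) (hq : X ∣ q) : (aeval M q).trace = 0 := by
    rw [aeval_eq_sum_range, Matrix.trace_sum]
    refine Finset.sum_eq_zero fun i _ => ?_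
    rcases Nat.eq_zero_or_pos i with rfl | hi
    · rw [X_dvd_iff.1 hq, zero_smul, Matrix.trace_zero]
    · rw [Matrix.trace_smul, h i hi, smul_zero]
  obtain ⟨q, hq, hXq⟩ := exists_eq_pow_rootMultiplicity_mul_and_not_dvd M.charpoly
    M.charpoly_monic.ne_zero 0
  rw [C_0, sub_zero] at hq hXq
  set a := M.charpoly.rootMultiplicity 0
  have hann (p : K[X]) (hp : X ^ a * q ∣ p) : aeval M p = 0 := by
    obtain ⟨r, rfl⟩ := hp
    rw [map_mul, ← hq, Matrix.aeval_self_charpoly, zero_mul]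
  obtain ⟨r, s, hrs⟩ : IsCoprime (X ^ (a + 1)) q :=
    ((irreducible_X.coprime_iff_not_dvd).2 hXq).pow_left
  -- `u` is the idempotent that projects onto the Fitting-one component of `M`.
  set u := r * X ^ (a + 1) with hu
  have hs : s * q = 1 - u := by rw [← hrs]; ring
  have hidem : IsIdempotentElem (aeval M u) := by
    rw [IsIdempotentElem, ← map_mul, ← sub_eq_zero, ← map_sub]
    refine hann _ ⟨-(r * X * s), ?_⟩
    calc u * u - u = -(u * (1 - u)) := by ring
      _ = _ := by rw [← hs, hu]; ring
  have hzero : aeval M u = 0 := by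
    have hid : IsIdempotentElem (Matrix.toLin' (aeval M u)) := by
      rw [IsIdempotentElem, Module.End.mul_eq_comp, ← Matrix.toLin'_mul, hidem.eq]
    have := (LinearMap.IsIdempotentElem.trace_eq_zero_iff hid).1
      (by rw [Matrix.trace_toLin'_eq]; exact htr _ ⟨r * X ^ a, by rw [hu]; ring⟩)
    simpa using this
  refine ⟨a, ?_⟩
  have := hann (X ^ a * (s * q)) ⟨s, by ring⟩
  rw [hs, mul_sub, mul_one, map_sub, map_mul, hzero, mul_zero, sub_zero, map_pow, aeval_X] at this
  exact this


/-! ### Matrix units in centralizers -/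

/-- Elements `e` and `f` of a ring that behave like the matrix units `E₁₂` and `E₂₁`: their products
`e * f` and `f * e` are orthogonal idempotents. -/
structure IsMatrixUnitPair {A : Type*} [Ring A] (e f : A) : Prop where
  e_mul_e : e * e = 0
  f_mul_f : f * f = 0
  e_mul_f_mul_e : e * f * e = e
  f_mul_e_mul_f : f * e * f = f
  e_ne_zero : e ≠ 0

theorem IsMatrixUnitPair.map {A B : Type*} [Ring A] [Ring B] {e f : A} (h : IsMatrixUnitPair e f)
    (φ : A →+* B) (hφ : Function.Injective φ) : IsMatrixUnitPair (φ e) (φ f) where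
  e_mul_e := by rw [← map_mul, h.e_mul_e, map_zero]
  f_mul_f := by rw [← map_mul, h.f_mul_f, map_zero]
  e_mul_f_mul_e := by rw [← map_mul, ← map_mul, h.e_mul_f_mul_e]
  f_mul_e_mul_f := by rw [← map_mul, ← map_mul, h.f_mul_e_mul_f]
  e_ne_zero := by rw [← map_zero φ]; exact hφ.ne h.e_ne_zero

/-- Over a principal ideal domain `R`, let `1 = ∑ p i` be a decomposition into orthogonal
idempotents of an algebra `A` whose corners `p i * A * p i` are quotients of `R ⧸ (q i ^ k i)` with
`q i` irreducible. Unless `A` contains a pair of matrix units, any trace on `A` that vanishes on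
nilpotents takes the same value on `a * b * c` and `b * a * c`.

If `p i * a * p j * b * p i` is invertible in its corner then `p i * a * p j` is one half of a pair
of matrix units. Otherwise all these elements are nilpotent, so the off-diagonal blocks do not
contribute to the trace of a product, and the diagonal blocks commute. -/
theorem exists_isMatrixUnitPair_or_trace_commutator_mul_eq_zero {R A B ι : Type*}
    [CommRing R] [IsDomain R] [IsPrincipalIdealRing R] [Ring A] [Algebra R A]
    [AddCommGroup B] [Fintype ι] [DecidableEq ι]
    (p : ι → A) (hp : CompleteOrthogonalIdempotents p) (q : ι → R) (hq : ∀ i, Irreducible (q i))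
    (k : ι → ℕ) (hqp : ∀ i, q i ^ k i • p i = 0)
    (hcorner : ∀ i a, ∃ r : R, p i * a * p i = r • p i)
    (τ : A →+ B) (hτ : ∀ a b, τ (a * b) = τ (b * a)) (hτn : ∀ a, IsNilpotent a → τ a = 0) :
    (∃ e f : A, IsMatrixUnitPair e f) ∨ ∀ a b c, τ ((a * b - b * a) * c) = 0 := by
  refine or_iff_not_imp_left.2 fun hne a b c => ?_
  have hpp (i) : p i * p i = p i := hp.idem i
  have hpo {i j} (hij : i ≠ j) : p i * p j = 0 := hp.ortho hij
  -- The trace ignores what passes through a different block.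
  have key {i j} (hij : i ≠ j) (x y : A) : τ (p i * x * p j * y) = 0 := by
    have hcyc : τ (p i * x * p j * y) = τ (p i * (x * p j * y) * p i) := by
      rw [hτ _ (p i)]; simp only [← mul_assoc, hpp]
    obtain ⟨r, hr⟩ := hcorner i (x * p j * y)
    rw [hcyc, hr]
    by_cases hdvd : q i ∣ r
    · refine hτn _ ⟨k i + 1, ?_⟩
      obtain ⟨s, rfl⟩ := hdvd
      rw [smul_pow, (hp.idem i).pow_succ_eq, mul_pow, pow_succ, mul_right_comm, mul_comm, mul_smul,
        mul_comm (q i ^ _), mul_smul, hqp, smul_zero, smul_zero]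
    · obtain ⟨u, v, huv⟩ : IsCoprime r (q i ^ k i) :=
        ((((hq i).coprime_iff_not_dvd).2 hdvd).symm).pow_right
      have hu : (u * r) • p i = p i := by
        have : (u * r + v * q i ^ k i) • p i = p i := by rw [huv, one_smul]
        rwa [add_smul, mul_smul v, hqp, smul_zero, add_zero] at this
      by_cases hpi : p i = 0
      · rw [hpi, smul_zero, map_zero]
      refine absurd ?_ hne
      have hef : (p i * x * p j) * (u • (p j * y * p i)) = p i := by
        rw [mul_smul_comm]
        calc u • (p i * x * p j * (p j * y * p i))
            = u • (p i * (x * (p j * p j) * y) * p i) := by simp only [mul_assoc]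
          _ = p i := by rw [hpp, hr, ← mul_smul, hu]
      refine ⟨p i * x * p j, u • (p j * y * p i), ?_, ?_, ?_, ?_, ?_⟩
      · calc p i * x * p j * (p i * x * p j) = p i * x * (p j * p i) * x * p j := by
              simp only [mul_assoc]
          _ = 0 := by rw [hpo hij.symm]; simp
      · rw [smul_mul_smul_comm]
        calc (u * u) • (p j * y * p i * (p j * y * p i))
            = (u * u) • (p j * y * (p i * p j) * y * p i) := by simp only [mul_assoc]
          _ = 0 := by rw [hpo hij]; simp
      · rw [hef]; simp only [← mul_assoc, hpp]
      · rw [mul_assoc, hef, smul_mul_assoc, mul_assoc, hpp]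
      · intro h0
        rw [h0, zero_mul] at hef
        exact hpi hef.symm
  have hoff {i} (x y : A) : τ (p i * x * y) = τ (p i * x * p i * y) := by
    conv_lhs => rw [← mul_one (p i * x), ← hp.complete, Finset.mul_sum, Finset.sum_mul, map_sum]
    exact Finset.sum_eq_single i (fun j _ hj => key hj.symm x y) (by simp)
  have hdiag (x y z : A) : τ (x * y * z) = ∑ i, τ (p i * x * p i * (p i * y * p i) * z) := by
    conv_lhs => rw [← one_mul (x * y * z), ← hp.complete, Finset.sum_mul, map_sum]
    refine Finset.sum_congr rfl fun i _ => ?_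
    calc τ (p i * (x * y * z)) = τ (p i * x * (y * z)) := by simp only [mul_assoc]
      _ = τ (p i * x * p i * (y * z)) := hoff _ _
      _ = τ (p i * x * p i * (p i * y * z)) := by
        rw [← mul_assoc, ← mul_assoc (p i * x * p i), ← mul_assoc (p i * x * p i) (p i),
          mul_assoc (p i * x) (p i) (p i), hpp]
      _ = τ (p i * y * (z * (p i * x * p i))) := by rw [hτ, mul_assoc]
      _ = τ (p i * y * p i * (z * (p i * x * p i))) := hoff _ _
      _ = _ := by rw [← mul_assoc, hτ, ← mul_assoc]
  rw [sub_mul, map_sub, hdiag, hdiag, sub_eq_zero]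
  refine Finset.sum_congr rfl fun i _ => ?_
  obtain ⟨r, hr⟩ := hcorner i a
  obtain ⟨s, hs⟩ := hcorner i b
  rw [hr, hs, smul_mul_smul_comm, smul_mul_smul_comm, mul_comm]

/-- A finitely generated torsion module over a principal ideal domain has a decomposition of the
identity into orthogonal idempotents whose corners in the endomorphism ring are cyclic and
annihilated by prime powers: the projections to the cyclic summands. -/
theorem exists_completeOrthogonalIdempotents_of_isTorsion.{u, v} {R : Type u} {M : Type v}
    [CommRing R] [IsDomain R] [IsPrincipalIdealRing R] [AddCommGroup M] [Module R M]
    [Module.Finite R M]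
    (hM : Module.IsTorsion R M) :
    ∃ (ι : Type u) (_ : Fintype ι) (_ : DecidableEq ι) (p : ι → Module.End R M) (q : ι → R)
      (k : ι → ℕ), CompleteOrthogonalIdempotents p ∧ (∀ i, Irreducible (q i)) ∧
      (∀ i, q i ^ k i • p i = 0) ∧
      ∀ i (a : Module.End R M), ∃ r : R, p i * a * p i = r • p i := by
  classical
  obtain ⟨ι, _, q, hq, k, ⟨ψ⟩⟩ := Module.equiv_directSum_of_isTorsion hM
  let φ := ψ.trans (DirectSum.linearEquivFunOnFintype R ι _)
  -- `ε i` and `σ i` are the projection to and the inclusion of the `i`-th cyclic summand.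
  let ε (i : ι) : M →ₗ[R] R ⧸ R ∙ q i ^ k i := LinearMap.proj i ∘ₗ φ.toLinearMap
  let σ (i : ι) : (R ⧸ R ∙ q i ^ k i) →ₗ[R] M :=
    φ.symm.toLinearMap ∘ₗ LinearMap.single R (fun i => R ⧸ R ∙ q i ^ k i) i
  have hεσ (i) (x) : ε i (σ i x) = x := by simp [ε, σ]
  have hεσ' {i j} (h : i ≠ j) (x) : ε i (σ j x) = 0 := by simp [ε, σ, h]
  have hsum (m : M) : ∑ i, σ i (ε i m) = m := by
    apply φ.injective
    rw [map_sum]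
    ext j
    simp [σ, ε, Finset.sum_apply]
  refine ⟨ι, inferInstance, inferInstance, fun i => σ i ∘ₗ ε i, q, k, ⟨⟨?_, ?_⟩, ?_⟩, hq, ?_, ?_⟩
  · intro i; ext m; simp [hεσ]
  · intro i j hij; ext m; simp [hεσ' hij]
  · ext m; simpa using hsum m
  · intro i
    ext m
    obtain ⟨r, hr⟩ := Submodule.Quotient.mk_surjective _ (ε i m)
    have : q i ^ k i • ε i m = 0 := by
      rw [← hr, ← Submodule.Quotient.mk_smul, Submodule.Quotient.mk_eq_zero, smul_eq_mul, mul_comm]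
      exact Submodule.smul_mem _ _ (Submodule.mem_span_singleton_self _)
    simp [← map_smul, this]
  · intro i a
    obtain ⟨r, hr⟩ := Submodule.Quotient.mk_surjective _ (ε i (a (σ i (Submodule.Quotient.mk 1))))
    -- An endomorphism of a cyclic module is multiplication by the coefficient `r` of the image of
    -- the generator.
    refine ⟨r, ?_⟩
    ext m
    obtain ⟨s, hs⟩ := Submodule.Quotient.mk_surjective _ (ε i m)
    have hs' : ε i m = s • Submodule.Quotient.mk 1 := by
      rw [← hs, ← Submodule.Quotient.mk_smul, smul_eq_mul, mul_one]
    have hr' : ε i (a (σ i (Submodule.Quotient.mk 1))) = r • Submodule.Quotient.mk 1 := by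
      rw [← hr, ← Submodule.Quotient.mk_smul, smul_eq_mul, mul_one]
    change σ i (ε i (a (σ i (ε i m)))) = r • σ i (ε i m)
    rw [hs', map_smul, map_smul, map_smul, hr', map_smul, map_smul, smul_comm]

open Polynomial Module in
/-- The centralizer of a linear map over a field of characteristic zero either contains matrix
units, or the trace form on it kills all commutators. -/
theorem LinearMap.exists_isMatrixUnitPair_or_trace_commutator_eq_zero {K V : Type*} [Field K]
    [CharZero K] [AddCommGroup V] [Module K V] [FiniteDimensional K V] (φ : Module.End K V) :
    (∃ e f : Module.End K V, Commute e φ ∧ Commute f φ ∧ IsMatrixUnitPair e f) ∨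
      ∀ a b c : Module.End K V, Commute a φ → Commute b φ → Commute c φ →
        LinearMap.trace K V ((a * b - b * a) * c) = 0 := by
  -- `ρ` identifies the endomorphisms of the `K[X]`-module defined by `φ` with the centralizer.
  let ρ : Module.End K[X] (AEval' φ) →+* Module.End K V :=
    { toFun a := (AEval'.of φ).symm.toLinearMap ∘ₗ a.restrictScalars K ∘ₗ (AEval'.of φ).toLinearMap
      map_one' := by ext; simp
      map_mul' a b := by ext; simp
      map_zero' := by ext; simp
      map_add' a b := by ext; simp }
  have hρ_apply (a) (v : V) : ρ a v = (AEval'.of φ).symm (a (AEval'.of φ v)) := rfl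
  have hρ_inj : Function.Injective ρ := by
    intro a b hab
    ext m
    have := LinearMap.congr_fun hab ((AEval'.of φ).symm m)
    simpa [hρ_apply] using this
  have hρ_comm (a) : Commute (ρ a) φ := by
    ext v
    change ρ a (φ v) = φ (ρ a v)
    rw [hρ_apply, hρ_apply, ← AEval'.X_smul_of, map_smul, AEval'.of_symm_X_smul]
  have hρ_surj (a : Module.End K V) (ha : Commute a φ) : ∃ b, ρ b = a := by
    refine ⟨LinearMap.ofAEval φ ((AEval'.of φ).toLinearMap ∘ₗ a) fun m => ?_, ?_⟩
    · change AEval'.of φ (a (φ m)) = (X : K[X]) • AEval'.of φ (a m)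
      rw [AEval'.X_smul_of]
      exact congrArg _ (LinearMap.congr_fun ha.eq m)
    · ext v; rfl
  obtain ⟨ι, _, _, p, q, k, hp, hq, hqp, hcorner⟩ :=
    exists_completeOrthogonalIdempotents_of_isTorsion
      (AEval.isTorsion_of_finiteDimensional K V φ)
  let τ : Module.End K[X] (AEval' φ) →+ K :=
    (LinearMap.trace K V).toAddMonoidHom.comp ρ.toAddMonoidHom
  have hτ (a) : τ a = LinearMap.trace K V (ρ a) := rfl
  rcases exists_isMatrixUnitPair_or_trace_commutator_mul_eq_zero p hp q hq k hqp hcorner τ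
    (fun a b => by rw [hτ, hτ, map_mul ρ, map_mul ρ, LinearMap.trace_mul_comm])
    (fun a ha => (LinearMap.isNilpotent_trace_of_isNilpotent (ha.map ρ)).eq_zero) with
    ⟨e, f, h⟩ | h
  · refine Or.inl ⟨ρ e, ρ f, hρ_comm e, hρ_comm f, ?_⟩
    constructor
    · rw [← map_mul, h.e_mul_e, map_zero]
    · rw [← map_mul, h.f_mul_f, map_zero]
    · rw [← map_mul, ← map_mul, h.e_mul_f_mul_e]
    · rw [← map_mul, ← map_mul, h.f_mul_e_mul_f]
    · rw [← map_zero ρ]; exact hρ_inj.ne h.e_ne_zero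
  · refine Or.inr fun a b c ha hb hc => ?_
    obtain ⟨a, rfl⟩ := hρ_surj a ha
    obtain ⟨b, rfl⟩ := hρ_surj b hb
    obtain ⟨c, rfl⟩ := hρ_surj c hc
    rw [← map_mul, ← map_mul, ← map_sub, ← map_mul]
    exact h a b c

/-- The centralizer of a matrix over a field of characteristic zero either contains matrix
units, or the trace form on it kills all commutators. -/
theorem Matrix.exists_isMatrixUnitPair_or_trace_commutator_eq_zero {K : Type*} [Field K]
    [CharZero K] {n : ℕ} (T : Matrix (Fin n) (Fin n) K) :
    (∃ e f : Matrix (Fin n) (Fin n) K, Commute e T ∧ Commute f T ∧ IsMatrixUnitPair e f) ∨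
      ∀ a b c : Matrix (Fin n) (Fin n) K, Commute a T → Commute b T → Commute c T →
        ((a * b - b * a) * c).trace = 0 := by
  let L : Matrix (Fin n) (Fin n) K ≃ₐ[K] Module.End K (Fin n → K) := Matrix.toLinAlgEquiv'
  rcases LinearMap.exists_isMatrixUnitPair_or_trace_commutator_eq_zero (L T) with
    ⟨e, f, he, hf, h⟩ | h
  · refine Or.inl ⟨L.symm e, L.symm f, ?_, ?_,
      h.map (L.symm : _ →+* Matrix (Fin n) (Fin n) K) L.symm.injective⟩
    · simpa using he.map L.symm
    · simpa using hf.map L.symm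
  · refine Or.inr fun a b c ha hb hc => ?_
    have := h (L a) (L b) (L c) (ha.map L) (hb.map L) (hc.map L)
    rw [← map_mul, ← map_mul, ← map_sub, ← map_mul] at this
    rw [← this]
    exact (Matrix.trace_toLin'_eq _).symm

/-! ### Extension of the base field -/

/-- The centralizer of a matrix with entries in a subfield is spanned by its elements with
entries in the subfield: the coordinates of a centralizing matrix with respect to a basis of the
field extension centralize as well. -/
theorem Matrix.mem_span_commute_map {K L : Type*} [Field K] [Field L] [Algebra K L] {n : ℕ}
    (T : Matrix (Fin n) (Fin n) K) {A : Matrix (Fin n) (Fin n) L}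
    (hA : Commute A (T.map (algebraMap K L))) :
    A ∈ Submodule.span L ((fun B : Matrix (Fin n) (Fin n) K => B.map (algebraMap K L)) ''
      {B | Commute B T}) := by
  classical
  let b := Module.Basis.ofVectorSpace K L
  have hcomm (i) : Commute (A.map (b.coord i)) T := by
    ext j k
    have h := congrArg (b.coord i) (congrFun (congrFun hA.eq j) k)
    simp only [Matrix.mul_apply, Matrix.map_apply, map_sum] at h ⊢
    convert h using 2 with l _ l _
    · rw [mul_comm (A j l), ← Algebra.smul_def, map_smul, smul_eq_mul, mul_comm]
    · rw [← Algebra.smul_def, map_smul, smul_eq_mul]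
  let S : Finset _ := Finset.univ.biUnion fun jk : Fin n × Fin n => (b.repr (A jk.1 jk.2)).support
  have hsum : A = ∑ i ∈ S, b i • (A.map (b.coord i)).map (algebraMap K L) := by
    ext j k
    rw [Matrix.sum_apply]
    simp only [Matrix.smul_apply, Matrix.map_apply, smul_eq_mul]
    conv_lhs => rw [← b.linearCombination_repr (A j k), Finsupp.linearCombination_apply]
    rw [Finsupp.sum_of_support_subset (s := S) _
      (Finset.subset_biUnion_of_mem (fun jk : Fin n × Fin n => (b.repr (A jk.1 jk.2)).support)
        (Finset.mem_univ (j, k))) _ (by simp)]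
    exact Finset.sum_congr rfl fun i _ => by rw [Algebra.smul_def, mul_comm]; rfl
  rw [hsum]
  exact Submodule.sum_mem _ fun i _ =>
    Submodule.smul_mem _ _ (Submodule.subset_span ⟨_, hcomm i, rfl⟩)

theorem Matrix.trace_commutator_eq_zero_of_map {K L : Type*} [Field K] [Field L] [Algebra K L]
    {n : ℕ} (T : Matrix (Fin n) (Fin n) K)
    (h : ∀ a b c : Matrix (Fin n) (Fin n) K, Commute a T → Commute b T → Commute c T →
      ((a * b - b * a) * c).trace = 0)
    {a b c : Matrix (Fin n) (Fin n) L} (ha : Commute a (T.map (algebraMap K L)))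
    (hb : Commute b (T.map (algebraMap K L))) (hc : Commute c (T.map (algebraMap K L))) :
    ((a * b - b * a) * c).trace = 0 := by
  replace ha := Matrix.mem_span_commute_map T ha
  induction ha using Submodule.span_induction with
  | zero => simp
  | add x y _ _ hx hy =>
    rw [← add_zero (0 : L)]
    nth_rw 1 [← hx]
    rw [← hy, ← Matrix.trace_add, ← add_mul]
    congr 2
    noncomm_ring
  | smul r x _ hx =>
    rw [smul_mul_assoc, mul_smul_comm, ← smul_sub, smul_mul_assoc, Matrix.trace_smul, hx, smul_zero]
  | mem a ha' =>
    obtain ⟨a, ha', rfl⟩ := ha'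
    replace hb := Matrix.mem_span_commute_map T hb
    induction hb using Submodule.span_induction with
    | zero => simp
    | add x y _ _ hx hy =>
      rw [← add_zero (0 : L)]
      nth_rw 1 [← hx]
      rw [← hy, ← Matrix.trace_add, ← add_mul]
      congr 2
      noncomm_ring
    | smul r x _ hx =>
      rw [smul_mul_assoc, mul_smul_comm, ← smul_sub, smul_mul_assoc, Matrix.trace_smul, hx,
        smul_zero]
    | mem b hb' =>
      obtain ⟨b, hb', rfl⟩ := hb'
      replace hc := Matrix.mem_span_commute_map T hc
      induction hc using Submodule.span_induction with
      | zero => simp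
      | add x y _ _ hx hy => rw [mul_add, Matrix.trace_add, hx, hy, add_zero]
      | smul r x _ hx => rw [mul_smul_comm, Matrix.trace_smul, hx, smul_zero]
      | mem c hc' =>
        obtain ⟨c, hc', rfl⟩ := hc'
        have := congrArg (algebraMap K L) (h a b c ha' hb' hc')
        simp only [map_zero, AddMonoidHom.map_trace, Matrix.map_mul] at this
        simpa [Matrix.map_mul, Matrix.map_sub, AddMonoidHom.map_trace] using this


/-! ### Solvable groups of units -/

open scoped commutatorElement in
/-- The units of a ring that is commutative modulo a nilpotent ideal form a solvable group. -/
theorem isSolvable_units_of_commutator_mem {A : Type*} [Ring A] (J : Ideal A) [J.IsTwoSided]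
    (hJ : IsNilpotent J) (h : ∀ a b : A, a * b - b * a ∈ J) : Group.IsSolvable Aˣ := by
  let U (k : ℕ) : Subgroup Aˣ := (Units.map (Ideal.Quotient.mk (J ^ k)).toMonoidHom).ker
  have hU (k : ℕ) (u : Aˣ) : u ∈ U k ↔ (u : A) - 1 ∈ J ^ k := by
    rw [MonoidHom.mem_ker, Units.ext_iff, ← Ideal.Quotient.eq]
    rfl
  have hcomm (u v : Aˣ) : ((⁅u, v⁆ : Aˣ) : A) - 1 =
      (u * v - v * u : A) * ((u⁻¹ : Aˣ) * (v⁻¹ : Aˣ)) := by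
    have : (v : A) * u * (↑u⁻¹ * ↑v⁻¹) = 1 := by
      rw [mul_assoc, Units.mul_inv_cancel_left, Units.mul_inv]
    rw [commutatorElement_def, sub_mul, this]
    simp only [Units.val_mul, mul_assoc]
  have hder (k : ℕ) : derivedSeries Aˣ (k + 1) ≤ U (k + 1) := by
    induction k with
    | zero =>
      rw [derivedSeries_succ, Subgroup.commutator_le]
      intro u _ v _
      rw [hU, hcomm, zero_add, Submodule.pow_one]
      exact J.mul_mem_right _ (h _ _)
    | succ k ih =>
      rw [derivedSeries_succ, Subgroup.commutator_le]
      intro u hu v hv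
      have hu := (hU _ _).1 (ih hu)
      have hv := (hU _ _).1 (ih hv)
      rw [hU, hcomm]
      refine (J ^ (k + 1 + 1)).mul_mem_right _ ?_
      have heq : (u * v - v * u : A) = (u - 1) * (v - 1) - (v - 1) * (u - 1) := by noncomm_ring
      have hle : J ^ (k + 1) * J ^ (k + 1) ≤ J ^ (k + 1 + 1) := by
        rw [← Ideal.IsTwoSided.pow_add]; exact Ideal.pow_le_pow_right (by omega)
      rw [heq]
      exact sub_mem (hle (Ideal.mul_mem_mul hu hv)) (hle (Ideal.mul_mem_mul hv hu))
  obtain ⟨k, hk⟩ := hJ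
  refine ⟨k + 1, (Subgroup.eq_bot_iff_forall _).2 fun u hu => ?_⟩
  have := Ideal.pow_le_pow_right k.le_succ ((hU _ _).1 (hder k hu))
  rw [hk, Ideal.zero_eq_bot, Ideal.mem_bot, sub_eq_zero] at this
  exact Units.ext this

/-- If the trace form kills all commutators of the centralizer of a matrix, these commutators lie
in the Jacobson radical, and the invertible elements of the centralizer form a solvable group. -/
theorem Matrix.isSolvable_centralizer_of_trace_commutator_eq_zero {K : Type*} [Field K]
    [CharZero K] {n : ℕ} (T : GL (Fin n) K)
    (h : ∀ a b c : Matrix (Fin n) (Fin n) K, Commute a T.1 → Commute b T.1 → Commute c T.1 →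
      ((a * b - b * a) * c).trace = 0) :
    Group.IsSolvable (Subgroup.centralizer {T}) := by
  let A := Subalgebra.centralizer K {T.1}
  have hA (a : A) : Commute a.1 T.1 := (a.2 T.1 rfl).symm
  have : IsArtinianRing A := IsArtinianRing.of_finite K A
  have hmem (a b : A) : a * b - b * a ∈ Ring.jacobson A := by
    rw [← Ideal.jacobson_bot, Ideal.mem_jacobson_iff]
    intro y
    have hnil : IsNilpotent (y * (a * b - b * a)) := by
      rw [← IsNilpotent.map_iff (f := A.val) Subtype.val_injective]
      refine Matrix.isNilpotent_of_trace_pow_eq_zero _ fun k hk => ?_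
      obtain ⟨k, rfl⟩ := Nat.exists_eq_add_of_le hk
      have := h a b (((y * (a * b - b * a)) ^ k * y : A) : Matrix _ _ K) (hA _) (hA _) (hA _)
      rw [Matrix.trace_mul_comm] at this
      rw [add_comm, pow_succ, ← this]
      simp [mul_assoc]
    obtain ⟨z, hz⟩ := (hnil.isUnit_one_add).exists_left_inv
    refine ⟨z, ?_⟩
    rw [Ideal.mem_bot, sub_eq_zero, ← hz]
    noncomm_ring
  have hsol : Group.IsSolvable Aˣ :=
    isSolvable_units_of_commutator_mem (Ring.jacobson A) IsSemiprimaryRing.isNilpotent hmem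
  have hcen (g : Subgroup.centralizer {T}) : Commute T g.1 :=
    Subgroup.mem_centralizer_singleton_iff.1 g.2 |>.symm
  let ψ : Subgroup.centralizer {T} →* Aˣ :=
    { toFun g := ⟨⟨g.1.1, by
          rintro _ rfl; exact congrArg Units.val (hcen g).eq⟩, ⟨g⁻¹.1.1, by
          rintro _ rfl; exact congrArg Units.val (hcen g⁻¹).eq⟩,
          Subtype.ext (Units.mul_inv g.1), Subtype.ext (Units.inv_mul g.1)⟩
      map_one' := by ext : 2; rfl
      map_mul' _ _ := by ext : 2; rfl }
  refine Group.isSolvable_of_isSolvable_injective (f := ψ) fun g g' hgg => ?_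
  exact Subtype.ext (Units.ext (congrArg (fun u : Aˣ => (u : A).1) hgg))

theorem solvableRadical_eq_top {G : Type*} [Group G] (hG : Group.IsSolvable G) :
    solvableRadical G = ⊤ :=
  top_le_iff.1 <| le_sSup ⟨inferInstance,
    Group.isSolvable_of_isSolvable_injective (f := Subgroup.subtype ⊤)
      (Subgroup.subtype_injective _)⟩

theorem FreeGroup.mul_comm_of_subsingleton {X : Type*} [Subsingleton X] (a b : FreeGroup X) :
    a * b = b * a := by
  have hcl (c : FreeGroup X) : c ∈ Subgroup.closure (Set.range (FreeGroup.of (α := X))) := by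
    rw [FreeGroup.closure_range_of]; trivial
  have hcomm : ∀ x ∈ Set.range (FreeGroup.of (α := X)), ∀ y ∈ Set.range (FreeGroup.of (α := X)),
      x * y = y * x := by
    rintro _ ⟨x, rfl⟩ _ ⟨y, rfl⟩
    rw [Subsingleton.elim x y]
  have := Subgroup.isMulCommutative_closure hcomm
  exact congrArg Subtype.val (mul_comm' (⟨a, hcl a⟩ : Subgroup.closure _) ⟨b, hcl b⟩)

/-- A solvable group has no non-abelian free subgroup: such a subgroup has at least two free
generators, so it maps onto the symmetric group on five letters. -/
theorem not_containsNonabelianFreeSubgroup_of_isSolvable {G : Type*} [Group G]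
    (hG : Group.IsSolvable G) : ¬ ContainsNonabelianFreeSubgroup G := by
  classical
  rintro ⟨H, hH, a, b, hab⟩
  let X := IsFreeGroup.Generators H
  let e : FreeGroup X ≃* H := (IsFreeGroup.mulEquiv H)
  have hsol : Group.IsSolvable (FreeGroup X) :=
    Group.isSolvable_of_isSolvable_injective (f := H.subtype.comp e.toMonoidHom)
      (H.subtype_injective.comp e.injective)
  rcases subsingleton_or_nontrivial X with hX | ⟨x, y, hxy⟩
  · apply hab
    have := congrArg e (FreeGroup.mul_comm_of_subsingleton (e.symm a) (e.symm b))
    simpa using this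
  · let σ : Equiv.Perm (Fin 5) := finRotate 5
    let τ : Equiv.Perm (Fin 5) := Equiv.swap 0 1
    let f : FreeGroup X →* Equiv.Perm (Fin 5) := FreeGroup.lift fun z => if z = x then σ else τ
    have hf : Function.Surjective f := by
      rw [← MonoidHom.range_eq_top, ← top_le_iff,
        ← Equiv.Perm.closure_prime_cycle_swap (σ := σ) (τ := τ) (by norm_num) isCycle_finRotate
          (by decide) ⟨0, 1, by decide, rfl⟩, Subgroup.closure_le]
      rintro _ (rfl | rfl)
      · exact ⟨FreeGroup.of x, by simp [f]⟩
      · exact ⟨FreeGroup.of y, by simp [f, hxy.symm]⟩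
    exact Equiv.Perm.not_isSolvable_fin_5 (Group.isSolvable_of_surjective hf)

/-! ### Normal solvable subgroups and the radical of the trace form -/

/-- The radical of the trace form of an algebra of real matrices. -/
def Matrix.traceRadical {n : ℕ} (A : Subalgebra ℝ (Matrix (Fin n) (Fin n) ℝ)) :
    Submodule ℝ (Matrix (Fin n) (Fin n) ℝ) where
  carrier := {x | x ∈ A ∧ ∀ y ∈ A, (x * y).trace = 0}
  add_mem' hx hy := ⟨A.add_mem hx.1 hy.1, fun z hz => by
    rw [add_mul, Matrix.trace_add, hx.2 z hz, hy.2 z hz, add_zero]⟩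
  zero_mem' := ⟨A.zero_mem, fun z _ => by simp⟩
  smul_mem' r x hx := ⟨A.smul_mem hx.1 r, fun z hz => by
    rw [smul_mul_assoc, Matrix.trace_smul, hx.2 z hz, smul_zero]⟩

/-- The matrices that commute with the algebra `A` modulo the radical of its trace form. -/
def Matrix.centralModTraceRadical {n : ℕ} (A : Subalgebra ℝ (Matrix (Fin n) (Fin n) ℝ)) :
    Submodule ℝ (Matrix (Fin n) (Fin n) ℝ) where
  carrier := {x | ∀ y ∈ A, x * y - y * x ∈ traceRadical A}
  add_mem' {a b} ha hb y hy := by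
    have := add_mem (ha y hy) (hb y hy)
    rwa [show a * y - y * a + (b * y - y * b) = (a + b) * y - y * (a + b) by noncomm_ring] at this
  zero_mem' y _ := by simp
  smul_mem' r x hx y hy := by
    rw [smul_mul_assoc, mul_smul_comm, ← smul_sub]
    exact Submodule.smul_mem _ _ (hx y hy)

namespace Matrix

variable {n : ℕ} {A : Subalgebra ℝ (Matrix (Fin n) (Fin n) ℝ)}

theorem traceRadical_mul_mem_right {x a : Matrix (Fin n) (Fin n) ℝ} (hx : x ∈ traceRadical A)
    (ha : a ∈ A) : x * a ∈ traceRadical A :=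
  ⟨A.mul_mem hx.1 ha, fun y hy => by rw [mul_assoc]; exact hx.2 _ (A.mul_mem ha hy)⟩

theorem traceRadical_mul_mem_left {x a : Matrix (Fin n) (Fin n) ℝ} (hx : x ∈ traceRadical A)
    (ha : a ∈ A) : a * x ∈ traceRadical A :=
  ⟨A.mul_mem ha hx.1, fun y hy => by
    rw [mul_assoc, Matrix.trace_mul_comm, mul_assoc]; exact hx.2 _ (A.mul_mem hy ha)⟩

theorem isNilpotent_of_mem_traceRadical {x : Matrix (Fin n) (Fin n) ℝ} (hx : x ∈ traceRadical A) :
    IsNilpotent x := by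
  refine isNilpotent_of_trace_pow_eq_zero x fun k hk => ?_
  obtain ⟨k, rfl⟩ := Nat.exists_eq_add_of_le hk
  rw [pow_add, pow_one]
  exact hx.2 _ (A.pow_mem hx.1 k)

theorem mem_traceRadical_of_isNilpotent_mul {x : Matrix (Fin n) (Fin n) ℝ} (hx : x ∈ A)
    (h : ∀ y ∈ A, IsNilpotent (x * y)) : x ∈ traceRadical A :=
  ⟨hx, fun y hy => (isNilpotent_trace_of_isNilpotent (h y hy)).eq_zero⟩

/-- The quotient by the radical of the trace form is a semiprime ring. -/
theorem mem_traceRadical_of_mul_mul_mem {x : Matrix (Fin n) (Fin n) ℝ} (hx : x ∈ A)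
    (h : ∀ y ∈ A, x * y * x ∈ traceRadical A) : x ∈ traceRadical A := by
  refine mem_traceRadical_of_isNilpotent_mul hx fun y hy => ?_
  have := isNilpotent_of_mem_traceRadical (traceRadical_mul_mem_right (h y hy) hy)
  rw [mul_assoc, ← sq] at this
  exact this.of_pow

/-- A commutator that is central modulo the radical of the trace form lies in the radical:
all its powers are commutators up to the radical, so they have trace zero. -/
theorem commutator_mem_traceRadical {a b : Matrix (Fin n) (Fin n) ℝ} (ha : a ∈ A) (hb : b ∈ A)
    (h : a * b - b * a ∈ centralModTraceRadical A) : a * b - b * a ∈ traceRadical A := by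
  set z := a * b - b * a with hz
  have hzA : z ∈ A := A.sub_mem (A.mul_mem ha hb) (A.mul_mem hb ha)
  have hpow (k : ℕ) : z ^ k ∈ centralModTraceRadical A := by
    intro y hy
    induction k with
    | zero => simp
    | succ k ih =>
      have := add_mem (traceRadical_mul_mem_right (h y hy) (A.pow_mem hzA k))
        (traceRadical_mul_mem_left ih hzA)
      convert this using 1
      rw [pow_succ']
      noncomm_ring
  have hnil : IsNilpotent z := by
    refine isNilpotent_of_trace_pow_eq_zero z fun k hk => ?_
    obtain ⟨k, rfl⟩ := Nat.exists_eq_add_of_le hk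
    have h1 := (hpow k a ha).2 b hb
    have h2 : (z ^ k * b * a).trace = (a * z ^ k * b).trace := by
      rw [Matrix.trace_mul_comm, mul_assoc]
    rw [add_comm, pow_succ]
    nth_rw 2 [hz]
    rw [mul_sub, Matrix.trace_sub, ← mul_assoc, ← mul_assoc, h2, ← Matrix.trace_sub, ← sub_mul, h1]
  refine mem_traceRadical_of_isNilpotent_mul hzA fun y hy => ?_
  -- As `z` is central modulo the radical, nilpotency passes from `z` to its multiples.
  have hzy (k : ℕ) : (z * y) ^ k - z ^ k * y ^ k ∈ traceRadical A := by
    induction k with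
    | zero => simp
    | succ k ih =>
      have h1 := traceRadical_mul_mem_left ih (A.mul_mem hzA hy)
      have h2 := traceRadical_mul_mem_left
        (traceRadical_mul_mem_right (hpow k y hy) (A.pow_mem hy k)) hzA
      convert sub_mem h1 h2 using 1
      simp only [pow_succ']
      noncomm_ring
  obtain ⟨k, hk⟩ := hnil
  have := hzy k
  rw [hk, zero_mul, sub_zero] at this
  exact (isNilpotent_of_mem_traceRadical this).of_pow

/-- Herstein's argument: if the square of the inner derivation `D` of `m` vanishes modulo the
radical, then so does `D`. Indeed `D² = 0` gives `D x * D y = 0` for all `x` and `y`, hence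
`D x * y * D x = 0`. -/
theorem mem_centralModTraceRadical_of_commutator_commutator_mem {m : Matrix (Fin n) (Fin n) ℝ}
    (hm : m ∈ A)
    (h : ∀ x ∈ A, m * (m * x - x * m) - (m * x - x * m) * m ∈ traceRadical A) :
    m ∈ centralModTraceRadical A := by
  intro x hx
  have hD {x : Matrix (Fin n) (Fin n) ℝ} (hx : x ∈ A) : m * x - x * m ∈ A :=
    A.sub_mem (A.mul_mem hm hx) (A.mul_mem hx hm)
  have hprod {x y : Matrix (Fin n) (Fin n) ℝ} (hx : x ∈ A) (hy : y ∈ A) :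
      (m * x - x * m) * (m * y - y * m) ∈ traceRadical A := by
    -- `D² (x y) - D² x * y - x * D² y = 2 * D x * D y`
    have h1 := sub_mem (sub_mem (h (x * y) (A.mul_mem hx hy))
      (traceRadical_mul_mem_right (h x hx) hy)) (traceRadical_mul_mem_left (h y hy) hx)
    have h2 := (traceRadical A).smul_mem (2⁻¹ : ℝ) h1
    convert h2 using 1
    rw [eq_inv_smul_iff₀ two_ne_zero, two_smul]
    noncomm_ring
  refine mem_traceRadical_of_mul_mul_mem (hD hx) fun y hy => ?_
  have := sub_mem (hprod hx (A.mul_mem hy hx)) (traceRadical_mul_mem_right (hprod hx hy) hx)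
  convert this using 1
  noncomm_ring

end Matrix

section SolvableRadical

open Matrix Filter Topology

open scoped commutatorElement in
/-- A normal subgroup of the unit group of a real matrix algebra whose commutators are central
modulo the radical is itself central modulo the radical.

For `m` in the subgroup and `x` in the algebra, the commutators of `m` with its conjugates by
`1 + ε x` are central; the first-order term in `ε` shows that `[m, [x, m]] m⁻²` is central, and it
is a commutator. -/
theorem le_centralModTraceRadical_of_commutator {n : ℕ}
    {A : Subalgebra ℝ (Matrix (Fin n) (Fin n) ℝ)} {G : Subgroup (GL (Fin n) ℝ)}
    (hG : ∀ g, g ∈ G ↔ g.1 ∈ A) (M : Subgroup G) [M.Normal]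
    (hM : ∀ a ∈ M, ∀ b ∈ M, (⁅a, b⁆ : G).1.1 ∈ centralModTraceRadical A) :
    ∀ m ∈ M, m.1.1 ∈ centralModTraceRadical A := by
  intro m hm
  have hmA : m.1.1 ∈ A := (hG _).1 m.2
  have hmA' : (m⁻¹).1.1 ∈ A := (hG _).1 (m⁻¹).2
  set a : Matrix (Fin n) (Fin n) ℝ := m.1.1 with ha
  set b : Matrix (Fin n) (Fin n) ℝ := (m⁻¹).1.1 with hb
  have hab : a * b = 1 := Units.mul_inv m.1
  have hba : b * a = 1 := Units.inv_mul m.1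
  have hfirst (x : Matrix (Fin n) (Fin n) ℝ) (hx : x ∈ A) :
      (a * (x * a - a * x) - (x * a - a * x) * a) * b * b ∈ centralModTraceRadical A := by
    set d := x * a - a * x with hd
    let N (ε : ℝ) : Matrix (Fin n) (Fin n) ℝ := (1 + ε • x)⁻¹
    -- For `g = 1 + ε x`, the commutator of `a` and `g a g⁻¹` equals `1 + ε F(ε)`.
    let F (ε : ℝ) : Matrix (Fin n) (Fin n) ℝ :=
      (a * (d * N ε) - (d * N ε) * a) * b * ((1 + ε • x) * b * N ε)
    have hcont : Continuous fun ε : ℝ => 1 + ε • x := by fun_prop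
    have hdet0 : (1 + (0 : ℝ) • x).det ≠ 0 := by simp
    have hdet : ∀ᶠ ε : ℝ in 𝓝[≠] 0, (1 + ε • x).det ≠ 0 :=
      (hcont.matrix_det.continuousAt.eventually_ne hdet0).filter_mono nhdsWithin_le_nhds
    have hN : ContinuousAt N 0 := by
      refine ContinuousAt.congr (f := fun ε : ℝ => ((1 + ε • x).det)⁻¹ • (1 + ε • x).adjugate) ?_ ?_
      · exact (hcont.matrix_det.continuousAt.inv₀ hdet0).smul
          hcont.matrix_adjugate.continuousAt
      · exact Eventually.of_forall fun ε => by simp only [N, Matrix.inv_def, Ring.inverse_eq_inv']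
    have hF : Tendsto F (𝓝[≠] 0) (𝓝 (F 0)) := by
      refine ContinuousAt.tendsto (f := F) ?_ |>.mono_left nhdsWithin_le_nhds
      exact (((continuousAt_const.mul (continuousAt_const.mul hN)).sub
        ((continuousAt_const.mul hN).mul continuousAt_const)).mul continuousAt_const).mul
        ((hcont.continuousAt.mul continuousAt_const).mul hN)
    have hF0 : F 0 = (a * d - d * a) * b * b := by simp [F, N]
    rw [← hF0]
    refine (Submodule.closed_of_finiteDimensional (centralModTraceRadical A)).mem_of_tendsto hF ?_
    filter_upwards [hdet, self_mem_nhdsWithin] with ε hε hε0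
    have hunit : IsUnit (1 + ε • x).det := hε.isUnit
    let g : G := ⟨Matrix.nonsingInvUnit (1 + ε • x) hunit,
      (hG _).2 (A.add_mem A.one_mem (A.smul_mem hx ε))⟩
    have hgN : (1 + ε • x) * N ε = 1 := Matrix.mul_nonsing_inv _ hunit
    have hmem := hM m hm (g * m * g⁻¹) (Subgroup.Normal.conj_mem inferInstance m hm g)
    have hval : (⁅m, g * m * g⁻¹⁆ : G).1.1 =
        a * ((1 + ε • x) * a * N ε) * b * ((1 + ε • x) * b * N ε) := by
      rw [commutatorElement_def, show (g * m * g⁻¹)⁻¹ = g * m⁻¹ * g⁻¹ by group]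
      rfl
    have hconj : (1 + ε • x) * a * N ε = a + ε • (d * N ε) := by
      rw [← sub_eq_iff_eq_add', ← smul_mul_assoc, hd]
      calc (1 + ε • x) * a * N ε - a
          = (1 + ε • x) * a * N ε - a * ((1 + ε • x) * N ε) := by rw [hgN, mul_one]
        _ = (ε • x * a - a * (ε • x)) * N ε := by noncomm_ring
        _ = ε • (x * a - a * x) * N ε := by rw [smul_mul_assoc, mul_smul_comm, ← smul_sub]
    have hNg : N ε * (1 + ε • x) = 1 := Matrix.nonsing_inv_mul _ hunit
    have hinv : ((1 + ε • x) * a * N ε) * ((1 + ε • x) * b * N ε) = 1 := by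
      calc ((1 + ε • x) * a * N ε) * ((1 + ε • x) * b * N ε)
          = (1 + ε • x) * (a * (N ε * (1 + ε • x)) * b) * N ε := by simp only [mul_assoc]
        _ = 1 := by rw [hNg, mul_one, hab, mul_one, hgN]
    have heq : (⁅m, g * m * g⁻¹⁆ : G).1.1 - 1 = ε • F ε := by
      rw [hval]
      calc a * ((1 + ε • x) * a * N ε) * b * ((1 + ε • x) * b * N ε) - 1
          = (a * ((1 + ε • x) * a * N ε) - ((1 + ε • x) * a * N ε) * a) * b *
              ((1 + ε • x) * b * N ε) := by
            rw [sub_mul, sub_mul, mul_assoc _ a b, hab, mul_one, hinv]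
        _ = ε • F ε := by
            rw [hconj, mul_add, add_mul, add_sub_add_left_eq_sub, mul_smul_comm, smul_mul_assoc,
              ← smul_sub, smul_mul_assoc, smul_mul_assoc]
    have h1 : (1 : Matrix (Fin n) (Fin n) ℝ) ∈ centralModTraceRadical A := fun y _ => by simp
    have := sub_mem hmem h1
    rw [heq] at this
    exact ((centralModTraceRadical A).smul_mem_iff hε0).1 this
  refine mem_centralModTraceRadical_of_commutator_commutator_mem hmA fun x hx => ?_
  have hdA : x * a - a * x ∈ A := A.sub_mem (A.mul_mem hx hmA) (A.mul_mem hmA hx)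
  set d := x * a - a * x with hd
  -- The first-order term is itself a commutator, because `b = a⁻¹` commutes with `a`.
  have hz : (a * d - d * a) * b * b = a * (d * b * b) - d * b * b * a := by
    rw [mul_assoc (d * b), hba, mul_one, sub_mul, sub_mul, mul_assoc d a b, hab, mul_one]
    simp only [mul_assoc]
  have hJ : (a * d - d * a) * b * b ∈ traceRadical A := by
    have := hfirst x hx
    rw [hz] at this ⊢
    exact commutator_mem_traceRadical hmA (A.mul_mem (A.mul_mem hdA hmA') hmA') this
  have := neg_mem (traceRadical_mul_mem_right (traceRadical_mul_mem_right hJ hmA) hmA)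
  rw [mul_assoc _ b a, hba, mul_one, mul_assoc _ b a, hba, mul_one] at this
  convert this using 1
  rw [hd]
  noncomm_ring

/-- The solvable radical of the unit group of a real matrix algebra is central modulo the
radical of the trace form. Climbing the derived series of a normal solvable subgroup from its
trivial term, each term is normal and has its commutators in the next one. -/
theorem coe_mem_centralModTraceRadical_of_mem_solvableRadical {n : ℕ}
    {A : Subalgebra ℝ (Matrix (Fin n) (Fin n) ℝ)} {G : Subgroup (GL (Fin n) ℝ)}
    (hG : ∀ g, g ∈ G ↔ g.1 ∈ A) {r : G} (hr : r ∈ solvableRadical G) :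
    r.1.1 ∈ centralModTraceRadical A := by
  -- Since the solvable radical is a supremum, the elements in question must form a subgroup.
  let Z : Subgroup G :=
    { carrier := {g | g.1.1 ∈ centralModTraceRadical A}
      one_mem' := fun y _ => by simp
      mul_mem' := fun {g h} hg hh y hy => by
        have := add_mem (traceRadical_mul_mem_left (hh y hy) ((hG _).1 g.2))
          (traceRadical_mul_mem_right (hg y hy) ((hG _).1 h.2))
        convert this using 1
        change g.1.1 * h.1.1 * y - y * (g.1.1 * h.1.1) = _
        noncomm_ring
      inv_mem' := fun {g} hg y hy => by
        have := neg_mem (traceRadical_mul_mem_left (traceRadical_mul_mem_right (hg y hy)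
          ((hG _).1 (g⁻¹).2)) ((hG _).1 (g⁻¹).2))
        convert this using 1
        have h1 : g.1.1 * (g⁻¹).1.1 = 1 := Units.mul_inv g.1
        have h2 : (g⁻¹).1.1 * g.1.1 = 1 := Units.inv_mul g.1
        rw [sub_mul, mul_sub, mul_assoc y, h1, mul_one, mul_assoc g.1.1, ← mul_assoc _ g.1.1, h2,
          one_mul, neg_sub] }
  suffices solvableRadical G ≤ Z from this hr
  refine sSup_le ?_
  rintro N ⟨hN, ⟨k, hk⟩⟩
  have hstep (j : ℕ) : j ≤ k → (derivedSeries N (k - j)).map N.subtype ≤ Z := by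
    induction j with
    | zero => intro _; rw [Nat.sub_zero, hk, Subgroup.map_bot]; exact bot_le
    | succ j ih =>
      intro hj
      have ih := ih (by omega)
      rw [show k - j = k - (j + 1) + 1 by omega, derivedSeries_succ, Subgroup.map_commutator] at ih
      exact le_centralModTraceRadical_of_commutator hG _ fun a ha b hb =>
        ih (Subgroup.commutator_mem_commutator ha hb)
  have := hstep k le_rfl
  rw [Nat.sub_self, derivedSeries_zero] at this
  intro g hg
  exact this ⟨⟨g, hg⟩, trivial, rfl⟩

/-! ### Non-compactness -/

/-- The unit `1 + x` of a ring, for `x` of square zero. -/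
def Units.oneAddOfSqZero {A : Type*} [Ring A] (x : A) (hx : x * x = 0) : Aˣ where
  val := 1 + x
  inv := 1 - x
  val_inv := by rw [mul_sub, add_mul, add_mul, hx]; simp
  inv_val := by rw [mul_add, sub_mul, sub_mul, hx]; simp

/-- If a real matrix algebra contains matrix units `e` and `f`, the quotient of its unit group by
the solvable radical is not compact: the function `g ↦ tr (g e g⁻¹ e)` is invariant under the
solvable radical, and unbounded on the one-parameter group `1 + t f`. -/
theorem not_compactSpace_quotient_solvableRadical {n : ℕ}
    {A : Subalgebra ℝ (Matrix (Fin n) (Fin n) ℝ)} {G : Subgroup (GL (Fin n) ℝ)}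
    (hG : ∀ g, g ∈ G ↔ g.1 ∈ A) {e f : Matrix (Fin n) (Fin n) ℝ} (he : e ∈ A) (hf : f ∈ A)
    (hef : IsMatrixUnitPair e f) : ¬ CompactSpace (G ⧸ solvableRadical G) := by
  intro hcpt
  let Φ (g : G) : ℝ := (g.1.1 * e * (g⁻¹).1.1 * e).trace
  have hΦ : Continuous Φ := by
    have h1 : Continuous fun g : G => g.1.1 := Units.continuous_val.comp continuous_subtype_val
    have h2 : Continuous fun g : G => (g⁻¹).1.1 := h1.comp continuous_inv
    exact (((h1.mul continuous_const).mul h2).mul continuous_const).matrix_trace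
  have hinv (g r : G) (hr : r ∈ solvableRadical G) : Φ (g * r) = Φ g := by
    have hJ := coe_mem_centralModTraceRadical_of_mem_solvableRadical hG hr e he
    have hJ' := traceRadical_mul_mem_left (traceRadical_mul_mem_right
      (traceRadical_mul_mem_right hJ ((hG _).1 (r⁻¹).2)) ((hG _).1 (g⁻¹).2)) ((hG _).1 g.2)
    have h0 := hJ'.2 e he
    have hr1 : r.1.1 * (r⁻¹).1.1 = 1 := Units.mul_inv r.1
    rw [sub_mul, mul_assoc e, hr1, mul_one, sub_mul, mul_sub, sub_mul, Matrix.trace_sub,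
      sub_eq_zero] at h0
    have hgr : (g * r).1.1 = g.1.1 * r.1.1 := rfl
    have hgr' : ((g * r)⁻¹).1.1 = (r⁻¹).1.1 * (g⁻¹).1.1 := by rw [_root_.mul_inv_rev]; rfl
    simp only [Φ, hgr, hgr']
    simpa only [mul_assoc] using h0
  let Ψ : G ⧸ solvableRadical G → ℝ := Quotient.lift Φ fun a b hab => by
    have := hinv a (a⁻¹ * b) (QuotientGroup.leftRel_apply.1 hab)
    rw [mul_inv_cancel_left] at this
    exact this.symm
  have hΨ : Continuous Ψ := hΦ.quotient_lift _
  obtain ⟨C, hC⟩ := isCompact_univ.exists_bound_of_continuousOn hΨ.continuousOn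
  have htr : (f * e).trace ≠ 0 := by
    have hid : IsIdempotentElem (Matrix.toLin' (f * e)) := by
      rw [IsIdempotentElem, Module.End.mul_eq_comp, ← Matrix.toLin'_mul, mul_assoc,
        ← mul_assoc e, hef.e_mul_f_mul_e]
    rw [← Matrix.trace_toLin'_eq, Ne, LinearMap.IsIdempotentElem.trace_eq_zero_iff hid]
    intro h
    have h0 : f * e = 0 := (Matrix.toLin' (R := ℝ)).injective (h.trans (map_zero _).symm)
    exact hef.e_ne_zero (by rw [← hef.e_mul_f_mul_e, mul_assoc, h0, mul_zero])
  have hff (t : ℝ) : (t • f) * (t • f) = 0 := by rw [smul_mul_smul_comm, hef.f_mul_f, smul_zero]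
  let u (t : ℝ) : G := ⟨Units.oneAddOfSqZero (t • f) (hff t),
    (hG _).2 (A.add_mem A.one_mem (A.smul_mem hf t))⟩
  have hu (t : ℝ) : Φ (u t) = -t ^ 2 * (f * e).trace := by
    change ((1 + t • f) * e * (1 - t • f) * e).trace = _
    have h1 : (1 + t • f) * e * (1 - t • f) * e =
        e * e - t • (e * f * e) + t • (f * (e * e)) - (t * t) • (f * (e * f * e)) := by
      simp only [add_mul, mul_sub, sub_mul, one_mul, mul_one, smul_mul_assoc, mul_smul_comm,
        mul_assoc, mul_smul, smul_add]
      abel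
    have he0 : e.trace = 0 := by
      rw [← hef.e_mul_f_mul_e, Matrix.trace_mul_comm, ← mul_assoc, hef.e_mul_e, zero_mul,
        Matrix.trace_zero]
    rw [h1, hef.e_mul_e, hef.e_mul_f_mul_e, mul_zero, smul_zero, add_zero, zero_sub,
      Matrix.trace_sub, Matrix.trace_neg, Matrix.trace_smul, Matrix.trace_smul, he0, smul_eq_mul,
      smul_eq_mul]
    ring
  have hb (t : ℝ) : t ^ 2 * |(f * e).trace| ≤ C := by
    have := hC (QuotientGroup.mk (u t)) trivial
    change ‖Φ (u t)‖ ≤ C at this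
    rwa [hu, Real.norm_eq_abs, abs_mul, abs_neg, abs_of_nonneg (sq_nonneg t)] at this
  have hpos : 0 < |(f * e).trace| := abs_pos.2 htr
  have hC0 : 0 ≤ C := by simpa using hb 0
  have h1 := hb (C / |(f * e).trace| + 1)
  have h2 : C / |(f * e).trace| * |(f * e).trace| = C := div_mul_cancel₀ _ hpos.ne'
  have h3 : 0 ≤ C / |(f * e).trace| := by positivity
  nlinarith

end SolvableRadical

/-! ### Free subgroups generated by unipotents -/

theorem Units.oneAddOfSqZero_zpow {A : Type*} [Ring A] (x : A) (hx : x * x = 0) (k : ℤ) :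
    ((Units.oneAddOfSqZero x hx ^ k : Aˣ) : A) = 1 + k • x := by
  have h1 : ((Units.oneAddOfSqZero x hx : Aˣ) : A) = 1 + x := rfl
  have h2 : (((Units.oneAddOfSqZero x hx)⁻¹ : Aˣ) : A) = 1 - x := rfl
  induction k using Int.induction_on with
  | zero => simp
  | succ k ih =>
    rw [zpow_add_one, Units.val_mul, ih, h1, add_mul, mul_add, smul_mul_assoc, mul_add, hx,
      add_smul]
    simp only [mul_one, one_mul, add_zero, one_smul]
    abel
  | pred k ih =>
    rw [zpow_sub_one, Units.val_mul, ih, h2, add_mul, mul_sub, smul_mul_assoc, mul_sub, hx,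
      sub_smul]
    simp only [mul_one, one_mul, sub_zero, one_smul]
    abel

open Function Pointwise in
/-- Ping-pong for two unipotent elements: if `e` and `f` behave like matrix units and `2 ≤ |a|`,
then `1 + a e` and `1 + a f` generate a free group. The two players are the parts
`|β| < |α|` and `|α| < |β|` of the plane of all `α • (e * f) + β • f`. -/
theorem IsMatrixUnitPair.injective_freeGroup_lift {A : Type*} [Ring A] [Algebra ℚ A] {e f : A}
    (h : IsMatrixUnitPair e f) {a : ℚ} (ha : 2 ≤ |a|) (g : Bool → Aˣ)
    (hg₀ : g false = Units.oneAddOfSqZero (a • e) (by simp [h.e_mul_e]))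
    (hg₁ : g true = Units.oneAddOfSqZero (a • f) (by simp [h.f_mul_f])) :
    Injective (FreeGroup.lift g) := by
  have hv0 : e * f ≠ 0 := fun h0 => h.e_ne_zero (by rw [← h.e_mul_f_mul_e, h0, zero_mul])
  set v := e * f with hv
  have hev : e * v = 0 := by rw [hv, ← mul_assoc, h.e_mul_e, zero_mul]
  have hfv : f * v = f := by rw [hv, ← mul_assoc, h.f_mul_e_mul_f]
  have hindep {α β α' β' : ℚ} (heq : α • v + β • f = α' • v + β' • f) : α = α' ∧ β = β' := by
    have h1 := congrArg (f * ·) heq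
    have h2 := congrArg (e * ·) heq
    simp only [mul_add, mul_smul_comm, hev, hfv, h.f_mul_f, ← hv, smul_zero, add_zero,
      zero_add] at h1 h2
    have hf0 : f ≠ 0 := fun h0 => hv0 (by rw [hv, h0, mul_zero])
    exact ⟨smul_left_injective ℚ hf0 h1, smul_left_injective ℚ hv0 h2⟩
  have hlarge {k : ℤ} (hk : k ≠ 0) {α β : ℚ} (hlt : |α| < |β|) : |β| < |α + k * a * β| := by
    have h1 : (1 : ℚ) ≤ |(k : ℚ)| := by exact_mod_cast Int.one_le_abs hk
    have h2 : 2 * |β| ≤ |k * a * β| := by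
      rw [abs_mul, abs_mul]
      exact mul_le_mul_of_nonneg_right (by nlinarith) (abs_nonneg _)
    have h3 := abs_sub_abs_le_abs_add (k * a * β) α
    rw [add_comm α]
    linarith
  have hcomp : FreeGroup.lift g = (Monoid.CoprodI.lift fun i => FreeGroup.lift fun _ => g i).comp
      (@freeGroupEquivCoprodI Bool).toMonoidHom := by
    ext i; simp
  rw [hcomp, MonoidHom.coe_comp]
  refine Injective.comp ?_ (MulEquiv.injective freeGroupEquivCoprodI)
  let X (i : Bool) : Set A :=
    {x | ∃ α β : ℚ, x = α • v + β • f ∧ bif i then |α| < |β| else |β| < |α|}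
  refine Monoid.CoprodI.lift_injective_of_ping_pong (fun i : Bool => FreeGroup.lift fun _ => g i)
    (Or.inr ⟨true, ?_⟩) X ?_ ?_ ?_
  · exact (Cardinal.natCast_lt_aleph0 (n := 3)).le.trans (Cardinal.aleph0_le_mk _)
  · rintro (_ | _)
    · exact ⟨_, 1, 0, rfl, by simp⟩
    · exact ⟨_, 0, 1, rfl, by simp⟩
  · have hdisj : Disjoint (X false) (X true) := by
      rw [Set.disjoint_left]
      rintro x ⟨α, β, rfl, hlt⟩ ⟨α', β', heq, hlt'⟩
      obtain ⟨rfl, rfl⟩ := hindep heq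
      exact lt_asymm hlt hlt'
    rintro (_ | _) (_ | _) hij
    · exact absurd rfl hij
    · exact hdisj
    · exact hdisj.symm
    · exact absurd rfl hij
  · intro i j hij
    refine FreeGroup.freeGroupUnitEquivInt.forall_congr_left.mpr fun k hk => ?_
    have hk0 : k ≠ 0 := by
      rintro rfl
      exact hk (by simp [FreeGroup.freeGroupUnitEquivInt])
    change FreeGroup.lift (fun _ => g i) (FreeGroup.of () ^ k) • X j ⊆ X i
    rw [map_zpow, FreeGroup.lift_apply_of]
    rintro _ ⟨_, ⟨α, β, rfl, hlt⟩, rfl⟩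
    change ((g i ^ k : Aˣ) : A) * (α • v + β • f) ∈ X i
    rcases i with _ | _ <;> rcases j with _ | _
    · exact absurd rfl hij
    · refine ⟨α + k * a * β, β, ?_, hlarge hk0 hlt⟩
      rw [hg₀, Units.oneAddOfSqZero_zpow, add_mul, one_mul, smul_mul_assoc, smul_mul_assoc,
        mul_add, mul_smul_comm, mul_smul_comm, hev, ← hv, smul_zero, zero_add,
        ← Int.cast_smul_eq_zsmul ℚ, smul_smul, smul_smul, add_smul]
      abel
    · refine ⟨α, β + k * a * α, ?_, hlarge hk0 hlt⟩
      rw [hg₁, Units.oneAddOfSqZero_zpow, add_mul, one_mul, smul_mul_assoc, smul_mul_assoc,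
        mul_add, mul_smul_comm, mul_smul_comm, hfv, h.f_mul_f, smul_zero, add_zero,
        ← Int.cast_smul_eq_zsmul ℚ, smul_smul, smul_smul, add_smul]
      abel
    · exact absurd rfl hij

theorem containsNonabelianFreeSubgroup_of_injective {G : Type*} [Group G] (φ : FreeGroup Bool →* G)
    (hφ : Function.Injective φ) : ContainsNonabelianFreeSubgroup G := by
  let e : FreeGroup Bool ≃* φ.range := MonoidHom.ofInjective hφ
  refine ⟨φ.range, IsFreeGroup.ofMulEquiv e, e (FreeGroup.of false), e (FreeGroup.of true), ?_⟩
  rw [← map_mul, ← map_mul, e.injective.ne_iff]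
  intro h
  have := congrArg FreeGroup.toWord h
  revert this
  decide

/-- Finitely many rational matrices have a common multiplier that makes them integral. -/
theorem Matrix.exists_intCast_map_eq_smul {n : ℕ} (e f : Matrix (Fin n) (Fin n) ℚ) :
    ∃ a : ℤ, a ≠ 0 ∧ ∃ E F : Matrix (Fin n) (Fin n) ℤ,
      E.map (algebraMap ℤ ℚ) = (a : ℚ) • e ∧ F.map (algebraMap ℤ ℚ) = (a : ℚ) • f := by
  obtain ⟨a, ha⟩ := IsLocalization.exist_integer_multiples_of_finite (nonZeroDivisors ℤ)
    (fun i : Bool × Fin n × Fin n => (bif i.1 then f else e) i.2.1 i.2.2)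
  choose c hc using ha
  refine ⟨a, nonZeroDivisors.coe_ne_zero a, Matrix.of fun i j => c (false, i, j),
    Matrix.of fun i j => c (true, i, j), ?_, ?_⟩
  · ext i j
    simpa [Algebra.smul_def] using hc (false, i, j)
  · ext i j
    simpa [Algebra.smul_def] using hc (true, i, j)

/-- If the centralizer of a rational matrix contains matrix units `e` and `f`, then for a suitable
integer `a` the matrices `1 + a e` and `1 + a f` are integral and generate a free group. -/
theorem containsNonabelianFreeSubgroup_integralCentralizer {n : ℕ} (T : GL (Fin n) ℚ)
    {e f : Matrix (Fin n) (Fin n) ℚ} (he : Commute e T.1) (hf : Commute f T.1)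
    (hef : IsMatrixUnitPair e f) : ContainsNonabelianFreeSubgroup (integralCentralizer T) := by
  obtain ⟨a, ha0, E, F, hE, hF⟩ := Matrix.exists_intCast_map_eq_smul e f
  have hinj : Function.Injective ((algebraMap ℤ ℚ).mapMatrix (m := Fin n)) :=
    Matrix.map_injective (algebraMap ℤ ℚ).injective_int
  let ρ : GL (Fin n) ℤ →* GL (Fin n) ℚ := Matrix.GeneralLinearGroup.map (algebraMap ℤ ℚ)
  have hunit (x : Matrix (Fin n) (Fin n) ℚ) (hx : Commute x T.1) (hxx : x * x = 0)
      (X : Matrix (Fin n) (Fin n) ℤ) (hX : X.map (algebraMap ℤ ℚ) = (a : ℚ) • x) :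
      ∃ g : integralCentralizer T, ρ g.1 =
        Units.oneAddOfSqZero (((2 * a : ℤ) : ℚ) • x) (by simp [hxx]) := by
    have hXX : (2 • X) * (2 • X) = 0 := by
      have : X * X = 0 := by
        apply hinj
        rw [map_mul, map_zero]
        change X.map (algebraMap ℤ ℚ) * X.map (algebraMap ℤ ℚ) = 0
        rw [hX, smul_mul_smul_comm, hxx, smul_zero]
      rw [smul_mul_smul_comm, this, smul_zero]
    have hρ : ρ (Units.oneAddOfSqZero (2 • X) hXX) =
        Units.oneAddOfSqZero (((2 * a : ℤ) : ℚ) • x) (by simp [hxx]) := by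
      apply Units.ext
      change (algebraMap ℤ ℚ).mapMatrix (1 + 2 • X) = 1 + ((2 * a : ℤ) : ℚ) • x
      rw [map_add, map_one, map_nsmul]
      change 1 + 2 • X.map (algebraMap ℤ ℚ) = _
      rw [hX, Int.cast_mul, mul_smul]
      norm_cast
    refine ⟨⟨Units.oneAddOfSqZero (2 • X) hXX, ?_⟩, hρ⟩
    rw [Subgroup.mem_comap, Subgroup.mem_centralizer_singleton_iff]
    change ρ _ * T = T * ρ _
    rw [hρ]
    apply Units.ext
    exact ((Commute.one_left T.1).add_left (hx.smul_left _)).eq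
  -- The factor `2` in the multiplier `2 * a` ensures the bound needed for ping-pong.
  obtain ⟨g₀, hg₀⟩ := hunit e he hef.e_mul_e E hE
  obtain ⟨g₁, hg₁⟩ := hunit f hf hef.f_mul_f F hF
  let φ : FreeGroup Bool →* integralCentralizer T := FreeGroup.lift fun i => bif i then g₁ else g₀
  refine containsNonabelianFreeSubgroup_of_injective φ ?_
  have ha2 : (2 : ℚ) ≤ |((2 * a : ℤ) : ℚ)| := by
    have : 1 ≤ |a| := Int.one_le_abs ha0
    rw [← Int.cast_abs, abs_mul]
    exact_mod_cast (by simpa using this : (2 : ℤ) ≤ |2| * |a|)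
  have hinj' := hef.injective_freeGroup_lift ha2 (fun i => ρ (bif i then g₁ else g₀).1) hg₀ hg₁
  have hcomp : FreeGroup.lift (fun i => ρ (bif i then g₁ else g₀).1) =
      (ρ.comp (integralCentralizer T).subtype).comp φ := by
    ext1 i; simp [φ]
  rw [hcomp, MonoidHom.coe_comp] at hinj'
  exact hinj'.of_comp


/-! ### The dichotomy -/

theorem proposition13 (n : ℕ) (T : GL (Fin n) ℚ) :
    ¬ CompactSpace (realCentralizer T ⧸ solvableRadical (realCentralizer T)) ↔
      ContainsNonabelianFreeSubgroup (integralCentralizer T) := by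
  have hcoe : (Matrix.GeneralLinearGroup.map (algebraMap ℚ ℝ) T).1 = T.1.map (algebraMap ℚ ℝ) := rfl
  rcases Matrix.exists_isMatrixUnitPair_or_trace_commutator_eq_zero T.1 with
    ⟨e, f, he, hf, hef⟩ | h
  · refine iff_of_true ?_ (containsNonabelianFreeSubgroup_integralCentralizer T he hf hef)
    have hmap {x : Matrix (Fin n) (Fin n) ℚ} (hx : Commute x T.1) :
        (algebraMap ℚ ℝ).mapMatrix x ∈
          Subalgebra.centralizer ℝ {T.1.map (algebraMap ℚ ℝ)} := by
      rw [Subalgebra.mem_centralizer_iff]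
      rintro _ rfl
      exact (hx.map (algebraMap ℚ ℝ).mapMatrix).eq.symm
    refine not_compactSpace_quotient_solvableRadical
      (A := Subalgebra.centralizer ℝ {T.1.map (algebraMap ℚ ℝ)}) (fun g => ?_) (hmap he) (hmap hf)
      (hef.map _ (Matrix.map_injective (algebraMap ℚ ℝ).injective))
    rw [Subgroup.mem_centralizer_singleton_iff, Subalgebra.mem_centralizer_iff, Units.ext_iff]
    simp [eq_comm]
  · have hsol : Group.IsSolvable (realCentralizer T) :=
      Matrix.isSolvable_centralizer_of_trace_commutator_eq_zero _ fun a b c ha hb hc =>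
        Matrix.trace_commutator_eq_zero_of_map T.1 h ha hb hc
    have hsol' : Group.IsSolvable (integralCentralizer T) := by
      have hsolQ := Matrix.isSolvable_centralizer_of_trace_commutator_eq_zero T h
      let ρ : GL (Fin n) ℤ →* GL (Fin n) ℚ := Matrix.GeneralLinearGroup.map (algebraMap ℤ ℚ)
      have hρ : Function.Injective ρ :=
        Units.map_injective (Matrix.map_injective (algebraMap ℤ ℚ).injective_int)
      exact Group.isSolvable_of_isSolvable_injective
        (f := ρ.subgroupComap (Subgroup.centralizer {T}))
        fun x y hxy => Subtype.ext (hρ (congrArg Subtype.val hxy))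
    refine iff_of_false (not_not.2 ?_) (not_containsNonabelianFreeSubgroup_of_isSolvable hsol')
    rw [solvableRadical_eq_top hsol]
    have : Subsingleton (realCentralizer T ⧸ (⊤ : Subgroup (realCentralizer T))) :=
      QuotientGroup.subsingleton_quotient_top
    infer_instance
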